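/- Let $p$ be a prime, $e\ge 2$ an integer, and let $j$ be the smallest positive integer with $e\mid p^j+1$ (assumed to exist). Let $s\ge 2$, $n=p^{2js}$ and $r=(n-1)/e$ (an integer). Then there is a strongly regular Cayley graph with parameters $$(n^2,\ r(n+1),\ -n+r^2+3r,\ r^2+r).$$ It is obtained by lifting the semi-primitive cyclotomic strongly regular graph, as follows. Let $K=\mathbb F_n$, $L=\mathbb F_{n^2}\supset K$, let $\gamma$ be any primitive element of $L$, $\omega=\mathrm N_{L/K}(\gamma)$, and $C_0=\langle\omega^e\rangle\le K^*$. Then $C_0$ has index $e$ in $K^*$, $\mathbb F_p^*\le C_0=-C_0$, and $\mathrm{Cay}(K,C_0)$ is strongly regular. Let $H_0=\{x\mathbb F_p^*\in K^*/\mathbb F_p^* : \mathrm{Tr}_{K/\mathbb F_p}(x)=0\}$ be the Singer difference set. The numbers $|H_0\cap \omega^i C_0/\mathbb F_p^*|$, $0\le i<e$, take exactly two values, and for a suitable one of them the set $I\subseteq\{0,\dots,e-1\}$ of indices $i$ at which it is attained has exactly one element, and for $D=\bigcup_{i\in I}\gamma^i\langle\gamma^e\rangle\subset L$ one has $0\notin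 D=-D$ and $\mathrm{Cay}(L,D)$ is strongly regular with the parameters above. (Here $\mathrm{Cay}(G,D)$ is the graph on the additive group $G$ in which two vertices are adjacent iff their difference lies in $D$; complete and edgeless graphs are not called strongly regular.) -/

import Mathlib

open scoped Pointwise

/-- `Γ` is strongly regular with parameters `(v, k, lam, mu)`; as usual, complete and edgeless
graphs are not counted as strongly regular. -/
structure IsStronglyRegular {V : Type*} [Fintype V] (Γ : SimpleGraph V) (v k lam mu : ℕ) :
    Prop where
  srg : by classical exact Γ.IsSRGWith v k lam mu
  ne_bot : Γ ≠ ⊥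
  ne_top : Γ ≠ ⊤

/-- `D` is the connection set of a strongly regular Cayley graph `Cay(G, D)` on the additive
group `G`, with parameters `(v, k, lam, mu)`. Since `0 ∉ D` and `-D = D`, two vertices of
`SimpleGraph.addCayley D` are adjacent exactly when their difference lies in `D`. -/
structure IsStronglyRegularCayley {G : Type*} [AddGroup G] [Fintype G] (D : Set G)
    (v k lam mu : ℕ) : Prop where
  zero_notMem : (0 : G) ∉ D
  neg_eq : -D = D
  srg : IsStronglyRegular (SimpleGraph.addCayley D) v k lam mu

/-- The cyclotomic class `C_i = g ^ i ⟨g ^ e⟩` of order `e`, for a primitive element `g`,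
as a set of units. -/
def cyclotomicClass {K : Type*} [Field K] (g : Kˣ) (e i : ℕ) : Set Kˣ :=
  {x | ∃ h ∈ Subgroup.zpowers (g ^ e), x = g ^ i * h}

/-- The union of the cyclotomic classes `C_i`, `i ∈ I`, as a subset of the field. -/
def cyclotomicUnion {K : Type*} [Field K] (g : Kˣ) (e : ℕ) (I : Finset ℕ) : Set K :=
  {x | ∃ i ∈ I, ∃ u ∈ cyclotomicClass g e i, x = (u : K)}

/-- The subgroup `Fˣ` of `Kˣ`. -/
def scalarUnits (F K : Type*) [Field F] [Field K] [Algebra F K] : Subgroup Kˣ :=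
  (Units.map (algebraMap F K : F →* K)).range

/-- The Singer difference set `H₀` in `Kˣ / Fˣ`: the classes of the elements of trace zero
(the trace is `F`-linear, so this does not depend on the choice of representatives). -/
def singerSet (F K : Type*) [Field F] [Field K] [Algebra F K] : Set (Kˣ ⧸ scalarUnits F K) :=
  {c | ∃ x : Kˣ, Algebra.trace F K (x : K) = 0 ∧ c = QuotientGroup.mk x}

/-- The intersection number `|H₀ ∩ w ^ i C₀ / Fˣ|`. -/
noncomputable def singerNumber (F : Type*) {K : Type*} [Field F] [Field K] [Algebra F K]
    (w : Kˣ) (e i : ℕ) : ℕ :=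
  (singerSet F K ∩ (fun x : Kˣ => (QuotientGroup.mk x : Kˣ ⧸ scalarUnits F K)) ''
    cyclotomicClass w e i).ncard

/-- `I ⊆ {0, …, e - 1}` is the index set of a subdifference set of the Singer difference set:
the numbers `|H₀ ∩ w ^ i C₀ / Fˣ|`, `0 ≤ i < e`, take exactly two values, and `I` is the set of
indices at which one (either one) of these two values is attained. -/
def IsSubdifferenceIndexSet (F : Type*) {K : Type*} [Field F] [Field K] [Algebra F K]
    (w : Kˣ) (e : ℕ) (I : Finset ℕ) : Prop :=
  ∃ a b : ℕ, a ≠ b ∧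
    (∀ i < e, singerNumber F w e i = a ∨ singerNumber F w e i = b) ∧
    (∃ i < e, singerNumber F w e i = a) ∧ (∃ i < e, singerNumber F w e i = b) ∧
    ∀ i, i ∈ I ↔ i < e ∧ singerNumber F w e i = a

/-- The cyclotomic strongly regular graphs that can be lifted: `C₀ = ⟨w ^ e⟩` is a subgroup of
index `e` of `Kˣ` that contains `Fˣ`, and `Cay(K, C₀)` is strongly regular. -/
structure IsLiftableCyclotomic (F : Type*) {K : Type*} [Field F] [Field K] [Fintype K]
    [Algebra F K] (w : Kˣ) (e : ℕ) : Prop where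
  scalars_le : scalarUnits F K ≤ Subgroup.zpowers (w ^ e)
  index_eq : (Subgroup.zpowers (w ^ e)).index = e
  srg : ∃ v k lam mu : ℕ, IsStronglyRegularCayley (cyclotomicUnion w e {0}) v k lam mu

/-! Write `Q = p ^ j` and let `F` have `Q ^ (2 s)` elements. For the trace character `ψ`, the sum
`S(a) = ∑ ψ (x ^ (Q + 1) * a)` comes from a Hermitian form, and `S(a) ^ 2` is `|F|` times the size
of its radical, which is `1` or `Q ^ 2`. Moreover `S(a) = 1 + (Q + 1) η` with `η` a Gaussian period
of order `Q + 1`, so `S(a) ≡ 1` modulo `Q + 1`; this fixes the sign, and `S(a)` is `(-Q) ^ s` or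
`(-Q) ^ (s + 1)`. Since the periods sum to `-1`, exactly one class is exceptional. Merging classes,
for every `e ∣ Q + 1` the periods of order `e` equal `((-Q) ^ s - 1) / e`, except on one class,
where they are smaller by `(-Q) ^ s` (`exists_gaussPeriod_semiprimitive`).

This is used twice over `K`. Two values of the character sums make `Cay(K, C₀)` strongly regular
(`isStronglyRegularCayley_of_charSum`). The Singer intersection numbers are affine in the periods
(`mul_singerNumber_eq`), so they too take two values, one of them at a single index `i`.

Over `L` the same evaluation holds with `2 s` in place of `s`, and `(-Q) ^ (2 s) = n`. Every single
class of order `e`, in particular the `i`-th one, therefore has restricted eigenvalues `r` and `r -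
n`, from which the parameters follow. -/

/-! ### Strongly regular Cayley graphs from two-valued character sums. -/

/-- If the nontrivial character sums of a symmetric subset `D` of a finite field take at most the
two values `θ₁`, `θ₂`, then `Cay(F, D)` is strongly regular with restricted eigenvalues
`θ₁`, `θ₂`. -/
theorem isStronglyRegularCayley_of_charSum {F : Type*} [Field F] [Fintype F]
    {ψ : AddChar F ℂ} (hψ : ψ.IsPrimitive) {D : Finset F} (h0 : (0 : F) ∉ D)
    (hneg : ∀ x ∈ D, -x ∈ D) (hne : D.Nonempty) (hnt : ∃ x : F, x ≠ 0 ∧ x ∉ D) {θ₁ θ₂ : ℂ}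
    (h : ∀ b : F, b ≠ 0 → ∑ x ∈ D, ψ (x * b) = θ₁ ∨ ∑ x ∈ D, ψ (x * b) = θ₂) :
    ∃ lam mu : ℕ, (mu : ℂ) = D.card + θ₁ * θ₂ ∧ (lam : ℂ) = mu + θ₁ + θ₂ ∧
      IsStronglyRegularCayley (D : Set F) (Fintype.card F) D.card lam mu := by
  classical
  have hneg' : ∀ x, -x ∈ D ↔ x ∈ D := fun x => ⟨fun hx => by simpa using hneg _ hx, hneg x⟩
  set S : F → ℂ := fun b => ∑ x ∈ D, ψ (x * b) with hS
  set f : F → ℕ := fun g => (D.filter (fun x => x + g ∈ D)).card with hf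
  -- For `b ≠ 0` the value `S b` is a root of `(X - θ₁)(X - θ₂)`. At `b = 0` it is `D.card`, and `C`
  -- is the value of that polynomial there.
  set C : ℂ := (D.card : ℂ) ^ 2 - (θ₁ + θ₂) * D.card + θ₁ * θ₂ with hC
  have hcard : (Fintype.card F : ℂ) ≠ 0 := by exact_mod_cast Fintype.card_ne_zero
  have hSneg : ∀ b, ∑ x ∈ D, ψ (-x * b) = S b := fun b =>
    Finset.sum_nbij' (fun x => -x) (fun x => -x) hneg hneg (by simp) (by simp) (by simp)
  have horth : ∀ z : F, ∑ b, ψ (b * z) = if z = 0 then (Fintype.card F : ℂ) else 0 := by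
    intro z
    rw [AddChar.sum_mulShift z hψ]
    split_ifs <;> simp
  have hSsq : ∀ b, S b * S b = (θ₁ + θ₂) * S b - θ₁ * θ₂ + if b = 0 then C else 0 := by
    intro b
    by_cases hb : b = 0
    · simp only [hS, hb, mul_zero, AddChar.map_zero_eq_one, Finset.sum_const, nsmul_eq_mul,
        mul_one, if_true, hC]
      ring
    · rw [if_neg hb]
      rcases h b hb with h | h <;> simp only [hS] at h ⊢ <;> rw [h] <;> ring
  -- Since `D = -D`, `S b` is also the sum over `-D`, so `S b * S b` is the Fourier transform of the
  -- difference count `f`.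
  have hcount : ∀ g, (Fintype.card F : ℂ) * f g = ∑ b, S b * S b * ψ (b * g) := by
    intro g
    have : ∀ b, S b * S b * ψ (b * g) = ∑ x ∈ D, ∑ y ∈ D, ψ (b * (x + g - y)) := by
      intro b
      nth_rewrite 2 [← hSneg b]
      rw [Finset.sum_mul_sum, Finset.sum_mul]
      refine Finset.sum_congr rfl fun x _ => ?_
      rw [Finset.sum_mul]
      refine Finset.sum_congr rfl fun y _ => ?_
      rw [← AddChar.map_add_eq_mul, ← AddChar.map_add_eq_mul]
      congr 1
      ring
    simp_rw [this]
    rw [Finset.sum_comm]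
    simp_rw [Finset.sum_comm (s := Finset.univ) (t := D), horth, sub_eq_zero]
    simp only [Finset.sum_ite_eq, hf, Finset.card_filter]
    push_cast
    rw [Finset.mul_sum]
    exact Finset.sum_congr rfl fun x _ => by split_ifs <;> simp
  have hS1 : ∀ g, ∑ b, S b * ψ (b * g) = if g ∈ D then (Fintype.card F : ℂ) else 0 := by
    intro g
    have : ∀ b, S b * ψ (b * g) = ∑ x ∈ D, ψ (b * (x + g)) := by
      intro b
      rw [Finset.sum_mul]
      refine Finset.sum_congr rfl fun x _ => ?_
      rw [← AddChar.map_add_eq_mul]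
      congr 1
      ring
    simp_rw [this]
    rw [Finset.sum_comm]
    simp_rw [horth, add_eq_zero_iff_eq_neg]
    rw [Finset.sum_ite_eq']
    simp only [hneg']
  -- Fourier inversion of the quadratic relation `hSsq`.
  have hmain : ∀ g, (Fintype.card F : ℂ) * f g =
      (Fintype.card F : ℂ) * ((θ₁ + θ₂) * (if g ∈ D then 1 else 0)
        - θ₁ * θ₂ * (if g = 0 then 1 else 0)) + C := by
    intro g
    rw [hcount]
    have : ∀ b, S b * S b * ψ (b * g) = (θ₁ + θ₂) * (S b * ψ (b * g)) - θ₁ * θ₂ * ψ (b * g)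
        + if b = 0 then C else 0 := by
      intro b
      rw [hSsq]
      by_cases hb : b = 0
      · subst hb
        simp
      · simp only [if_neg hb]
        ring
    simp_rw [this]
    rw [Finset.sum_add_distrib, Finset.sum_sub_distrib, ← Finset.mul_sum, ← Finset.mul_sum, hS1,
      horth, Finset.sum_ite_eq' Finset.univ (0 : F) (fun _ => C)]
    simp only [Finset.mem_univ, if_true]
    split_ifs <;> ring
  have hf0 : f 0 = D.card := by
    simp [hf]
  -- The case `g = 0`, where `f 0 = D.card`, determines `C`.
  have hCval : C = (Fintype.card F : ℂ) * (D.card + θ₁ * θ₂) := by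
    have := hmain 0
    rw [hf0] at this
    simp only [h0, if_false, if_true] at this
    linear_combination -this
  have hfval : ∀ g, g ≠ 0 → (f g : ℂ) = D.card + θ₁ * θ₂ + if g ∈ D then θ₁ + θ₂ else 0 := by
    intro g hg
    have := hmain g
    rw [hCval, if_neg hg] at this
    apply mul_left_cancel₀ hcard
    rw [this]
    split_ifs <;> ring
  -- `f d` and `f c` serve as the natural numbers `lam` and `mu`; `d` and `c` also show that the
  -- graph is neither empty nor complete.
  obtain ⟨d, hd⟩ := hne
  obtain ⟨c, hc0, hcD⟩ := hnt
  have hd0 : d ≠ 0 := fun h => h0 (h ▸ hd)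
  have hadj : ∀ u v, (SimpleGraph.addCayley (D : Set F)).Adj u v ↔ v - u ∈ D := by
    intro u v
    rw [SimpleGraph.addCayley_adj']
    constructor
    · rintro ⟨-, g, hg, rfl | rfl⟩
      · simpa using hg
      · simpa using hneg g hg
    · intro hm
      refine ⟨?_, v - u, hm, Or.inl (by ring)⟩
      rintro rfl
      simp [h0] at hm
  have hcommon : ∀ u v, Nat.card ((SimpleGraph.addCayley (D : Set F)).commonNeighbors u v) =
      f (u - v) := by
    intro u v
    rw [Nat.card_eq_fintype_card, ← Set.toFinset_card]
    refine Finset.card_bij' (fun x _ => x - u) (fun x _ => x + u) ?_ ?_ (by simp) (by simp)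
    · intro x hx
      simp only [Set.mem_toFinset, SimpleGraph.mem_commonNeighbors, hadj] at hx
      simp only [Finset.mem_filter]
      exact ⟨hx.1, by simpa using hx.2⟩
    · intro x hx
      simp only [Finset.mem_filter] at hx
      simp only [Set.mem_toFinset, SimpleGraph.mem_commonNeighbors, hadj]
      exact ⟨by simpa using hx.1, by simpa [add_sub_assoc] using hx.2⟩
  have hfd := hfval d hd0
  have hfc := hfval c hc0
  rw [if_pos hd] at hfd
  rw [if_neg hcD, add_zero] at hfc
  refine ⟨f d, f c, hfc, by rw [hfd, hfc]; ring, by simpa using h0, ?_, ?_⟩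
  · ext x
    simp [hneg']
  generalize SimpleGraph.addCayley (D : Set F) = Γ at hadj hcommon ⊢
  constructor
  · refine @SimpleGraph.IsSRGWith.mk _ _ _ _ _ _ _ _ rfl ?_ ?_ ?_
    · intro v
      rw [← SimpleGraph.card_neighborFinset_eq_degree]
      refine Finset.card_bij' (fun x _ => x - v) (fun x _ => x + v) ?_ ?_ (by simp) (by simp)
      · intro x hx
        simpa [hadj] using hx
      · intro x hx
        simpa [hadj] using hx
    · intro u v huv
      rw [hadj] at huv
      have huv' : u - v ∈ D := by simpa using hneg _ huv
      have hne : u - v ≠ 0 := fun h => h0 (h ▸ huv')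
      have := hfval _ hne
      rw [if_pos huv', ← hfd] at this
      rw [← Nat.card_eq_fintype_card, hcommon]
      exact_mod_cast this
    · intro u v hne huv
      rw [hadj, ← hneg', neg_sub] at huv
      have := hfval _ (sub_ne_zero.2 hne)
      rw [if_neg huv, add_zero, ← hfc] at this
      rw [← Nat.card_eq_fintype_card, hcommon]
      exact_mod_cast this
  · intro hbot
    have : Γ.Adj 0 d := by rw [hadj]; simpa using hd
    rw [hbot] at this
    exact this
  · intro htop
    have : Γ.Adj 0 c := by rw [htop]; exact hc0.symm
    rw [hadj] at this
    exact hcD (by simpa using this)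

/-! ### The trace character. -/

/-- The canonical additive character `x ↦ exp (2πi Tr(x) / p)` of a finite field of
characteristic `p`. -/
noncomputable def traceChar (p : ℕ) [Fact p.Prime] (F : Type*) [Field F] [Algebra (ZMod p) F] :
    AddChar F ℂ :=
  (ZMod.stdAddChar (N := p)).compAddMonoidHom (Algebra.trace (ZMod p) F).toAddMonoidHom

theorem traceChar_apply (p : ℕ) [Fact p.Prime] {F : Type*} [Field F] [Algebra (ZMod p) F]
    (x : F) :
    traceChar p F x = ZMod.stdAddChar (N := p) (Algebra.trace (ZMod p) F x) := rfl

theorem traceChar_isPrimitive (p : ℕ) [Fact p.Prime] {F : Type*} [Field F] [Fintype F]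
    [Algebra (ZMod p) F] : (traceChar p F).IsPrimitive := by
  apply AddChar.IsPrimitive.of_ne_one
  intro h
  obtain ⟨x, hx⟩ := Algebra.trace_surjective (ZMod p) F 1
  have h1 : traceChar p F x = 1 := by rw [h]; rfl
  rw [traceChar_apply, hx] at h1
  have := ZMod.isPrimitive_stdAddChar p
  rw [AddChar.IsPrimitive.zmod_char_eq_one_iff p this] at h1
  exact one_ne_zero h1

theorem traceChar_pow (p : ℕ) [Fact p.Prime] {F : Type*} [Field F] [Fintype F]
    [Algebra (ZMod p) F] (x : F) (i : ℕ) : traceChar p F (x ^ p ^ i) = traceChar p F x := by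
  have key : ∀ y : F, traceChar p F (y ^ p) = traceChar p F y := by
    intro y
    have := Algebra.trace_eq_of_algEquiv (FiniteField.frobeniusAlgEquivOfAlgebraic (ZMod p) F) y
    rw [FiniteField.coe_frobeniusAlgEquivOfAlgebraic, ZMod.card] at this
    rw [traceChar_apply, traceChar_apply, this]
  induction i with
  | zero => simp
  | succ i ih => rw [pow_succ, pow_mul, key, ih]

theorem traceChar_isIntegral (p : ℕ) [Fact p.Prime] {F : Type*} [Field F] [Algebra (ZMod p) F]
    (x : F) : IsIntegral ℤ (traceChar p F x) := by
  have hp := (Fact.out : p.Prime).pos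
  refine IsIntegral.of_pow hp ?_
  rw [← AddChar.map_nsmul_eq_pow]
  have : p • x = 0 := by
    have : CharP F p := charP_of_injective_algebraMap (algebraMap (ZMod p) F).injective p
    simp
  rw [this, AddChar.map_zero_eq_one]
  exact isIntegral_one

/-- The conjugates of `u` with exponents `p ^ i` and `p ^ (j + i)` are opposite, so the trace, cut
into `s` blocks of `2 * j` conjugates, vanishes. -/
theorem traceChar_eq_one (p : ℕ) [Fact p.Prime] {F : Type*} [Field F] [Fintype F]
    [Algebra (ZMod p) F] {j s : ℕ} (hF : Fintype.card F = p ^ (2 * j * s)) {u : F}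
    (hu : u ^ p ^ j = -u) : traceChar p F u = 1 := by
  have hp := (Fact.out : p.Prime)
  have hrank : Module.finrank (ZMod p) F = 2 * j * s := by
    have := Module.card_eq_pow_finrank (K := ZMod p) (V := F)
    rw [hF, ZMod.card] at this
    exact (Nat.pow_right_injective hp.two_le this).symm
  have htr : Algebra.trace (ZMod p) F u = 0 := by
    apply (algebraMap (ZMod p) F).injective
    rw [FiniteField.algebraMap_trace_eq_sum_pow, map_zero, hrank]
    simp only [Nat.card_zmod]
    have : CharP F p := charP_of_injective_algebraMap (algebraMap (ZMod p) F).injective p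
    have h1 : ∀ i, u ^ p ^ (j + i) = -u ^ p ^ i := by
      intro i
      rw [pow_add, pow_mul, hu]
      have := map_neg (iterateFrobenius F p i) u
      simpa only [iterateFrobenius_def] using this
    clear hF hrank
    induction s with
    | zero => simp
    | succ m ih =>
      rw [show 2 * j * (m + 1) = 2 * j * m + j + j by ring, Finset.sum_range_add,
        Finset.sum_range_add, ih, zero_add, ← Finset.sum_add_distrib]
      refine Finset.sum_eq_zero fun i _ => ?_
      rw [show 2 * j * m + j + i = j + (2 * j * m + i) by ring, h1, add_neg_cancel]
  rw [traceChar_apply, htr, AddChar.map_zero_eq_one]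

/-! ### Scalars as `e`-th powers. -/

/-- In a cyclic group of units, elements killed by `m` are `d`-th powers if `d * m` divides the
group order. -/
theorem mem_zpowers_pow_of_pow_eq_one {G : Type*} [Group G] [Finite G] {g : G}
    (hg : ∀ x : G, x ∈ Subgroup.zpowers g) {d m : ℕ} (hm : m ≠ 0) (hd : d * m ∣ Nat.card G) {x : G}
    (hx : x ^ m = 1) : x ∈ Subgroup.zpowers (g ^ d) := by
  obtain ⟨k, rfl⟩ := Subgroup.mem_zpowers_iff.1 (hg x)
  have ho : orderOf g = Nat.card G := orderOf_eq_card_of_forall_mem_zpowers hg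
  rw [← zpow_natCast, ← zpow_mul, ← orderOf_dvd_iff_zpow_eq_one, ho] at hx
  have h2 : ((d * m : ℕ) : ℤ) ∣ k * m := (Int.natCast_dvd_natCast.2 hd).trans hx
  push_cast at h2
  obtain ⟨c, rfl⟩ := Int.dvd_of_mul_dvd_mul_right (by exact_mod_cast hm) h2
  exact Subgroup.mem_zpowers_iff.2 ⟨c, by rw [zpow_mul, zpow_natCast]⟩

theorem scalarUnits_pow_eq_one (p : ℕ) [Fact p.Prime] {F : Type*} [Field F] [Algebra (ZMod p) F]
    {x : Fˣ} (hx : x ∈ scalarUnits (ZMod p) F) : x ^ (p - 1) = 1 := by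
  obtain ⟨y, rfl⟩ := hx
  rw [← map_pow, ZMod.units_pow_card_sub_one_eq_one, map_one]

theorem neg_one_mem_scalarUnits (p : ℕ) [Fact p.Prime] {F : Type*} [Field F]
    [Algebra (ZMod p) F] : (-1 : Fˣ) ∈ scalarUnits (ZMod p) F :=
  ⟨-1, by ext; simp⟩

/-- Divisibility needed for `𝔽_pˣ` to consist of `e`-th powers. -/
theorem mul_sub_one_dvd {p j s e : ℕ} (he : e ∣ p ^ j + 1) :
    e * (p - 1) ∣ p ^ (2 * j * s) - 1 := by
  have h1 : p ^ (2 * j) - 1 ∣ p ^ (2 * j * s) - 1 := by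
    rw [pow_mul p (2 * j) s]
    exact Nat.sub_one_dvd_pow_sub_one _ _
  refine dvd_trans ?_ h1
  have h2 : p ^ (2 * j) - 1 = (p ^ j + 1) * (p ^ j - 1) := by
    rw [← Nat.sq_sub_sq, one_pow, ← pow_mul, mul_comm j]
  rw [h2]
  exact mul_dvd_mul he (Nat.sub_one_dvd_pow_sub_one _ _)

/-! ### Evaluation of the Hermitian exponential sum. -/

/-- If there is a nonzero root `x₀`, the nonzero roots are the `u * x₀` with `u ^ (q - 1) = 1`, and
there are `q - 1` such `u`. With `q = p ^ (2 * j)` this is the size of the radical. -/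
theorem card_rad (F : Type*) [Field F] [Fintype F] [DecidableEq F] {q : ℕ} (hq : 2 ≤ q)
    (hqF : q - 1 ∣ Fintype.card F - 1) {a b : F} (hb : b ≠ 0) :
    (Finset.univ.filter fun x : F => x ^ q * b + x * a = 0).card = 1 ∨
      (Finset.univ.filter fun x : F => x ^ q * b + x * a = 0).card = q := by
  by_cases hx : ∃ x : F, x ≠ 0 ∧ x ^ q * b + x * a = 0
  · right
    obtain ⟨x₀, hx₀, h₀⟩ := hx
    have hpow : ∀ x : F, x ^ q = x * x ^ (q - 1) := fun x => by
      rw [← pow_succ', Nat.sub_add_cancel (by omega)]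
    have h₀' : a = -(x₀ ^ (q - 1) * b) := by
      rw [hpow] at h₀
      apply mul_left_cancel₀ hx₀
      linear_combination h₀
    have hker : (Finset.univ.filter fun u : Fˣ => u ^ (q - 1) = 1).card = q - 1 := by
      have := IsCyclic.card_powMonoidHom_ker (G := Fˣ) (q - 1)
      rw [Nat.card_units, Nat.card_eq_fintype_card (α := F), Nat.gcd_eq_right hqF] at this
      refine Eq.trans ?_ this
      rw [Nat.card_eq_fintype_card]
      exact (Fintype.card_of_subtype _ (by simp [MonoidHom.mem_ker])).symm
    have hset : (Finset.univ.filter fun x : F => x ^ q * b + x * a = 0) =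
        insert 0 ((Finset.univ.filter fun u : Fˣ => u ^ (q - 1) = 1).image
          fun u : Fˣ => (u : F) * x₀) := by
      ext x
      simp only [Finset.mem_filter, Finset.mem_univ, true_and, Finset.mem_insert,
        Finset.mem_image]
      constructor
      · intro hx
        by_cases hx0 : x = 0
        · exact Or.inl hx0
        · right
          refine ⟨Units.mk0 x hx0 * (Units.mk0 x₀ hx₀)⁻¹, ?_, by simp [hx₀]⟩
          rw [mul_pow, inv_pow, mul_inv_eq_one]
          ext
          simp only [Units.val_pow_eq_pow_val, Units.val_mk0]
          rw [hpow, h₀'] at hx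
          apply mul_right_cancel₀ hb
          apply mul_left_cancel₀ hx0
          linear_combination hx
      · rintro (rfl | ⟨u, hu, rfl⟩)
        · simp [show q ≠ 0 by omega]
        · have hu' : (u : F) ^ (q - 1) = 1 := by
            rw [← Units.val_pow_eq_pow_val, hu, Units.val_one]
          rw [hpow, mul_pow, hu', h₀']
          ring
    rw [hset, Finset.card_insert_of_notMem, Finset.card_image_of_injective, hker]
    · omega
    · intro u v huv
      exact Units.ext (mul_right_cancel₀ hx₀ huv)
    · simp [hx₀]
  · left
    push Not at hx
    rw [Finset.card_eq_one]
    refine ⟨0, ?_⟩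
    ext x
    simp only [Finset.mem_filter, Finset.mem_univ, true_and, Finset.mem_singleton]
    constructor
    · intro h
      by_contra h0
      exact hx x h0 h
    · rintro rfl
      simp [show q ≠ 0 by omega]

/-- Scaling `x` by `t` replaces `a` by `-a`, so the sum equals its conjugate and its square is a
double sum over `x + y` and `y`. After a Frobenius twist the cross terms are additive in `y ^ p ^
j`, so summing over `y` leaves only the `x` in the radical. There `u = x ^ (p ^ j + 1) * a`
satisfies `u ^ p ^ j = -u`, and the remaining factor is `1` by `traceChar_eq_one`. -/
theorem sum_traceChar_hermitian_mul_self (p : ℕ) [Fact p.Prime] {F : Type*} [Field F] [Fintype F]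
    [DecidableEq F] [Algebra (ZMod p) F] {j s : ℕ} (hF : Fintype.card F = p ^ (2 * j * s))
    {t : F} (ht : t ^ (p ^ j + 1) = -1) (a : F) :
    (∑ x : F, traceChar p F (x ^ (p ^ j + 1) * a)) * (∑ x : F, traceChar p F (x ^ (p ^ j + 1) * a))
      = Fintype.card F *
        (Finset.univ.filter fun x : F => x ^ (p ^ (2 * j)) * a ^ p ^ j + x * a = 0).card := by
  have hchar : CharP F p := charP_of_injective_algebraMap (algebraMap (ZMod p) F).injective p
  have ht0 : t ≠ 0 := by
    rintro rfl
    simp at ht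
  have hneg : ∑ x : F, traceChar p F (x ^ (p ^ j + 1) * a) =
      ∑ x : F, traceChar p F (-(x ^ (p ^ j + 1) * a)) := by
    refine (Fintype.sum_equiv (Equiv.mulLeft₀ t ht0) _ _ fun x => ?_).symm
    rw [Equiv.mulLeft₀_apply, mul_pow, ht, neg_one_mul, neg_mul]
  have hshift : ∀ y : F, (∑ x : F, traceChar p F (x ^ (p ^ j + 1) * a)) =
      ∑ x : F, traceChar p F ((x + y) ^ (p ^ j + 1) * a) := fun y =>
    (Fintype.sum_equiv (Equiv.addRight y) _ _ fun x => rfl).symm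
  have hexp : ∀ x y : F, traceChar p F ((x + y) ^ (p ^ j + 1) * a) *
      traceChar p F (-(y ^ (p ^ j + 1) * a)) = traceChar p F (x ^ (p ^ j + 1) * a) *
        traceChar p F (y ^ p ^ j * (x ^ (p ^ (2 * j)) * a ^ p ^ j + x * a)) := by
    intro x y
    have h1 : traceChar p F (y ^ p ^ j * (x ^ (p ^ (2 * j)) * a ^ p ^ j)) =
        traceChar p F (x ^ p ^ j * y * a) := by
      rw [← traceChar_pow p (x ^ p ^ j * y * a) j, mul_pow, mul_pow, ← pow_mul, ← pow_add,
        ← two_mul]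
      congr 1
      ring
    rw [mul_add, AddChar.map_add_eq_mul _ (y ^ p ^ j * _), h1, ← AddChar.map_add_eq_mul,
      ← AddChar.map_add_eq_mul, ← AddChar.map_add_eq_mul, pow_succ (x + y), add_pow_char_pow]
    congr 1
    ring
  have hfrob : ∀ w : F, ∑ y : F, traceChar p F (y ^ p ^ j * w) =
      if w = 0 then (Fintype.card F : ℂ) else 0 := by
    intro w
    have hb : Function.Bijective fun y : F => y ^ p ^ j :=
      Finite.injective_iff_bijective.1 (iterateFrobenius_inj F p j)
    rw [hb.sum_comp (fun y => traceChar p F (y * w)),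
      AddChar.sum_mulShift w (traceChar_isPrimitive p)]
    split_ifs <;> simp
  calc _ = ∑ y : F, ∑ x : F, traceChar p F ((x + y) ^ (p ^ j + 1) * a) *
      traceChar p F (-(y ^ (p ^ j + 1) * a)) := by
        conv_lhs => arg 2; rw [hneg]
        rw [Finset.mul_sum]
        refine Finset.sum_congr rfl fun y _ => ?_
        rw [hshift y, Finset.sum_mul]
    _ = ∑ x : F, if x ^ (p ^ (2 * j)) * a ^ p ^ j + x * a = 0 then (Fintype.card F : ℂ) else 0 := by
        rw [Finset.sum_comm]
        refine Finset.sum_congr rfl fun x _ => ?_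
        simp_rw [hexp]
        rw [← Finset.mul_sum, hfrob]
        split_ifs with h
        · rw [traceChar_eq_one p hF (j := j), one_mul]
          rw [mul_pow, ← pow_mul, show (p ^ j + 1) * p ^ j = p ^ (2 * j) + p ^ j by ring, pow_add]
          linear_combination x ^ p ^ j * h
        · simp
    _ = _ := by
        rw [← Finset.sum_filter, Finset.sum_const, nsmul_eq_mul, mul_comm]

/-- Sign determination: an integral `η` with `1 + (Q + 1) η` of square `Q ^ (2 m)` satisfies
`1 + (Q + 1) η = (-Q) ^ m`. -/
theorem eq_neg_pow_of_sq_eq {Q m : ℕ} (hQ : 2 ≤ Q) {η : ℂ} (hη : IsIntegral ℤ η)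
    (h : (1 + (Q + 1) * η) * (1 + (Q + 1) * η) = (Q : ℂ) ^ (2 * m)) :
    1 + (Q + 1) * η = (-Q : ℂ) ^ m := by
  have hN : ((Q : ℂ) + 1) ≠ 0 := by exact_mod_cast Nat.succ_ne_zero Q
  have h' : 1 + (Q + 1) * η = (-Q : ℂ) ^ m ∨ 1 + (Q + 1) * η = -(-Q : ℂ) ^ m := by
    apply mul_self_eq_mul_self_iff.1
    rw [h, ← mul_pow, neg_mul_neg, ← sq, ← pow_mul]
  refine h'.resolve_right fun h2 => ?_
  -- The assumed equation makes `η` rational, and a rational algebraic integer is an integer.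
  have hint : ∃ z : ℤ, (z : ℂ) = η := by
    have hr : algebraMap ℚ ℂ ((-(-Q : ℚ) ^ m - 1) / (Q + 1)) = η := by
      rw [eq_ratCast]
      push_cast
      rw [div_eq_iff hN]
      linear_combination -h2
    rw [← hr, isIntegral_algebraMap_iff (algebraMap ℚ ℂ).injective] at hη
    obtain ⟨z, hz⟩ := IsIntegrallyClosed.isIntegral_iff.1 hη
    refine ⟨z, ?_⟩
    rw [← hr, ← hz]
    simp
  obtain ⟨z, rfl⟩ := hint
  have h3 : 1 + ((Q : ℤ) + 1) * z = -(-Q : ℤ) ^ m := by exact_mod_cast h2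
  -- As `-Q ≡ 1` modulo `Q + 1`, the wrong sign would give `1 ≡ -1`, impossible because `Q + 1 > 2`.
  have h4 : ((Q : ℤ) + 1) ∣ (-Q : ℤ) ^ m - 1 := by
    have := sub_dvd_pow_sub_pow (-Q : ℤ) 1 m
    rw [one_pow] at this
    exact (dvd_trans ⟨-1, by ring⟩ this)
  have h5 : ((Q : ℤ) + 1) ∣ 2 := by
    obtain ⟨c, hc⟩ := h4
    exact ⟨-z - c, by linear_combination h3 - hc⟩
  have := Int.le_of_dvd (by norm_num) h5
  omega

/-! ### Gaussian periods. -/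

theorem sum_range_mul_eq_sum_sum {M : Type*} [AddCommMonoid M] (f : ℕ → M) (a b : ℕ) :
    ∑ i ∈ Finset.range (a * b), f i = ∑ i ∈ Finset.range b, ∑ t ∈ Finset.range a, f (t + a * i) := by
  induction b with
  | zero => simp
  | succ b ih =>
    rw [Nat.mul_succ, Finset.sum_range_add, ih, Finset.sum_range_succ]
    simp_rw [add_comm (a * b)]

theorem sum_units_eq_sum_range {G M : Type*} [Group G] [Fintype G] [AddCommMonoid M] {g : G}
    (hg : ∀ x : G, x ∈ Subgroup.zpowers g) (f : G → M) :
    ∑ x : G, f x = ∑ i ∈ Finset.range (Fintype.card G), f (g ^ i) := by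
  classical
  rw [← IsCyclic.image_range_card hg, Finset.sum_image, Nat.card_eq_fintype_card]
  intro a ha b hb hab
  have ho : orderOf g = Nat.card G := orderOf_eq_card_of_forall_mem_zpowers hg
  exact pow_injOn_Iio_orderOf (by simpa [ho] using ha) (by simpa [ho] using hb) hab

/-- The Gaussian period `∑ ψ(x)` over `x ∈ g ^ k ⟨g ^ e⟩`. -/
noncomputable def gaussPeriod {F : Type*} [Field F] [Fintype F] (ψ : AddChar F ℂ) (g : Fˣ)
    (e k : ℕ) : ℂ :=
  ∑ i ∈ Finset.range ((Fintype.card F - 1) / e), ψ ((g ^ (k + e * i) : Fˣ) : F)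

theorem pow_card_sub_one {F : Type*} [Field F] [Fintype F] (g : Fˣ) :
    g ^ (Fintype.card F - 1) = 1 := by
  classical
  rw [← Fintype.card_units, pow_card_eq_one]

/-- The shift drops the term `i = 0` and appends the term `i = (|F| - 1) / e`; they agree because `g
^ (|F| - 1) = 1`. -/
theorem gaussPeriod_add {F : Type*} [Field F] [Fintype F] (ψ : AddChar F ℂ) (g : Fˣ)
    {e : ℕ} (he : e ∣ Fintype.card F - 1) (k : ℕ) :
    gaussPeriod ψ g e (k + e) = gaussPeriod ψ g e k := by
  have h := Finset.sum_range_succ (fun i => ψ ((g ^ (k + e * i) : Fˣ) : F))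
    ((Fintype.card F - 1) / e)
  rw [Finset.sum_range_succ', Nat.mul_div_cancel' he, pow_add g k (Fintype.card F - 1),
    pow_card_sub_one] at h
  simp only [mul_zero, add_zero, mul_one] at h
  rw [gaussPeriod, gaussPeriod, ← add_right_cancel h]
  refine Finset.sum_congr rfl fun i _ => ?_
  congr 3
  ring

theorem gaussPeriod_add_mul {F : Type*} [Field F] [Fintype F] (ψ : AddChar F ℂ) (g : Fˣ)
    {e : ℕ} (he : e ∣ Fintype.card F - 1) (k i : ℕ) :
    gaussPeriod ψ g e (k + e * i) = gaussPeriod ψ g e k := by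
  induction i with
  | zero => simp
  | succ i ih => rw [Nat.mul_succ, ← add_assoc, gaussPeriod_add ψ g he, ih]

theorem gaussPeriod_mod {F : Type*} [Field F] [Fintype F] (ψ : AddChar F ℂ) (g : Fˣ)
    {e : ℕ} (he : e ∣ Fintype.card F - 1) (k : ℕ) :
    gaussPeriod ψ g e (k % e) = gaussPeriod ψ g e k := by
  conv_rhs => rw [← Nat.mod_add_div k e, gaussPeriod_add_mul ψ g he]

theorem gaussPeriod_one {F : Type*} [Field F] [Fintype F] {ψ : AddChar F ℂ}
    (hψ : ψ.IsPrimitive) {g : Fˣ} (hg : ∀ x : Fˣ, x ∈ Subgroup.zpowers g) :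
    gaussPeriod ψ g 1 0 = -1 := by
  classical
  have h := AddChar.sum_mulShift (1 : F) hψ
  rw [if_neg one_ne_zero, Nat.cast_zero] at h
  simp only [mul_one] at h
  rw [Fintype.sum_eq_add_sum_subtype_ne _ 0, AddChar.map_zero_eq_one,
    ← (unitsEquivNeZero (G₀ := F)).sum_comp (fun x => ψ (x : F))] at h
  have h2 := sum_units_eq_sum_range hg (fun x => ψ (x : F))
  rw [Fintype.card_units] at h2
  rw [gaussPeriod, Nat.div_one]
  simp only [zero_add, one_mul]
  rw [← h2]
  exact (eq_neg_of_add_eq_zero_right h)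

/-- A class of order `e` is the disjoint union of `c` classes of order `e * c`. -/
theorem gaussPeriod_mul {F : Type*} [Field F] [Fintype F] (ψ : AddChar F ℂ) (g : Fˣ)
    {e c : ℕ} (hc : c ≠ 0) (he : e ≠ 0) (hec : e * c ∣ Fintype.card F - 1) (k : ℕ) :
    gaussPeriod ψ g e k = ∑ t ∈ Finset.range c, gaussPeriod ψ g (e * c) (k + e * t) := by
  obtain ⟨m, hm⟩ := hec
  simp only [gaussPeriod]
  rw [Finset.sum_comm, hm, Nat.mul_div_cancel_left _ (by positivity), mul_assoc,
    Nat.mul_div_cancel_left _ (by positivity), sum_range_mul_eq_sum_sum]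
  refine Finset.sum_congr rfl fun i _ => Finset.sum_congr rfl fun t _ => ?_
  congr 3
  ring

theorem gaussPeriod_isIntegral (p : ℕ) [Fact p.Prime] {F : Type*} [Field F] [Fintype F]
    [Algebra (ZMod p) F] (g : Fˣ) (e k : ℕ) : IsIntegral ℤ (gaussPeriod (traceChar p F) g e k) :=
  IsIntegral.sum _ fun _ _ => traceChar_isIntegral p _

/-- The map `x ↦ x ^ e` is `e`-to-one on units, and `x = 0` contributes `1`. With `e = p ^ j + 1`
this links periods to the Hermitian sum. -/
theorem sum_pow_mul_eq_gaussPeriod {F : Type*} [Field F] [Fintype F] (ψ : AddChar F ℂ)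
    {g : Fˣ} (hg : ∀ x : Fˣ, x ∈ Subgroup.zpowers g) {e : ℕ} (he : e ∣ Fintype.card F - 1)
    (he0 : e ≠ 0) (k : ℕ) :
    ∑ x : F, ψ (x ^ e * ((g ^ k : Fˣ) : F)) = 1 + e * gaussPeriod ψ g e k := by
  classical
  rw [Fintype.sum_eq_add_sum_subtype_ne _ 0, zero_pow he0, zero_mul, AddChar.map_zero_eq_one,
    ← (unitsEquivNeZero (G₀ := F)).sum_comp (fun x => ψ ((x : F) ^ e * ((g ^ k : Fˣ) : F)))]
  have h2 := sum_units_eq_sum_range hg (fun x => ψ ((x : F) ^ e * ((g ^ k : Fˣ) : F)))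
  rw [Fintype.card_units] at h2
  congr 1
  refine Eq.trans h2 ?_
  obtain ⟨m, hm⟩ := he
  rw [gaussPeriod, hm, Nat.mul_div_cancel_left _ (by positivity), mul_comm e m, sum_range_mul_eq_sum_sum]
  rw [Finset.sum_congr rfl (g := fun _ => ∑ i ∈ Finset.range m, ψ ((g ^ (k + e * i) : Fˣ) : F)),
    Finset.sum_const, Finset.card_range, nsmul_eq_mul]
  intro i _
  refine Finset.sum_congr rfl fun t _ => ?_
  rw [← Units.val_pow_eq_pow_val, ← Units.val_mul]
  congr 2
  rw [← pow_mul, ← pow_add, show (t + m * i) * e + k = k + e * t + e * m * i by ring, ← hm,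
    pow_add, pow_mul g (Fintype.card F - 1), pow_card_sub_one, one_pow, mul_one]

/-- Counts the exceptional class of order `e * c` among the `c` classes into which a class of order
`e` splits. -/
theorem card_filter_modEq {e c : ℕ} (he : e ≠ 0) (hc : c ≠ 0) (k k₀ : ℕ) :
    ((Finset.range c).filter fun t => k + e * t ≡ k₀ [MOD e * c]).card =
      if k ≡ k₀ [MOD e] then 1 else 0 := by
  split_ifs with h
  · rw [Finset.card_eq_one]
    obtain ⟨m, hm⟩ := (Nat.modEq_iff_dvd.1 h)
    have hc' : (0 : ℤ) < c := by positivity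
    have hmod : (((m % c).toNat : ℕ) : ℤ) = m % c := Int.toNat_of_nonneg (Int.emod_nonneg _ hc'.ne')
    refine ⟨(m % c).toNat, ?_⟩
    ext t
    simp only [Finset.mem_filter, Finset.mem_range, Finset.mem_singleton]
    have key : k + e * t ≡ k₀ [MOD e * c] ↔ (c : ℤ) ∣ m - t := by
      rw [Nat.modEq_iff_dvd]
      push_cast
      rw [show (k₀ : ℤ) - (k + e * t) = e * (m - t) by linear_combination hm]
      exact mul_dvd_mul_iff_left (by exact_mod_cast he)
    rw [key, ← Int.natCast_inj, hmod]
    constructor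
    · rintro ⟨ht, hd⟩
      rw [Int.emod_eq_emod_iff_emod_sub_eq_zero.2 (Int.emod_eq_zero_of_dvd hd),
        Int.emod_eq_of_lt (by positivity) (by exact_mod_cast ht)]
    · intro ht
      refine ⟨?_, ?_⟩
      · have := Int.emod_lt_of_pos m hc'
        omega
      · rw [ht]
        exact Int.dvd_self_sub_emod
  · rw [Finset.card_eq_zero, Finset.filter_eq_empty_iff]
    intro t _ ht
    apply h
    have := ht.of_mul_right c
    simpa [Nat.ModEq] using this

/-! ### Semi-primitive evaluation of the periods. -/

/-- Semi-primitive Gaussian periods, for the full order `p ^ j + 1`. -/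
theorem exists_gaussPeriod_prime_pow_add_one (p : ℕ) [Fact p.Prime] {F : Type*} [Field F]
    [Fintype F] [Algebra (ZMod p) F] {j s : ℕ} (hj : 0 < j)
    (hF : Fintype.card F = p ^ (2 * j * s)) {g : Fˣ} (hg : ∀ x : Fˣ, x ∈ Subgroup.zpowers g) :
    ∃ k₀ : ℕ, ∀ k : ℕ, ((p : ℂ) ^ j + 1) * gaussPeriod (traceChar p F) g (p ^ j + 1) k =
      (-(p : ℂ) ^ j) ^ s - 1 - (if k ≡ k₀ [MOD p ^ j + 1] then
        ((p : ℂ) ^ j + 1) * (-(p : ℂ) ^ j) ^ s else 0) := by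
  classical
  have hp := (Fact.out : p.Prime)
  set Q := p ^ j with hQdef
  have hQ : 2 ≤ Q := hp.two_le.trans (Nat.le_self_pow hj.ne' p)
  have hQc : ((p : ℂ) ^ j) = (Q : ℂ) := by push_cast [hQdef]; rfl
  rw [hQc]
  have hQ0 : (Q : ℂ) ≠ 0 := by exact_mod_cast (by omega : Q ≠ 0)
  have hQ1 : (Q : ℂ) + 1 ≠ 0 := by exact_mod_cast Nat.succ_ne_zero Q
  have hdvd : (Q + 1) * (p - 1) ∣ Fintype.card F - 1 := hF ▸ mul_sub_one_dvd dvd_rfl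
  have hdvd1 : Q + 1 ∣ Fintype.card F - 1 := (dvd_mul_right _ _).trans hdvd
  -- `-1` lies in `𝔽_pˣ`, which consists of `(Q + 1)`-th powers since `(Q + 1) * (p - 1)` divides
  -- `|F| - 1`.
  obtain ⟨t, ht⟩ : ∃ t : F, t ^ (Q + 1) = -1 := by
    have := mem_zpowers_pow_of_pow_eq_one hg (d := Q + 1) (m := p - 1)
      (Nat.sub_ne_zero_of_lt hp.one_lt)
      (by rwa [Nat.card_units, Nat.card_eq_fintype_card])
      (scalarUnits_pow_eq_one p (neg_one_mem_scalarUnits p))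
    obtain ⟨z, hz⟩ := Subgroup.mem_zpowers_iff.1 this
    refine ⟨((g ^ z : Fˣ) : F), ?_⟩
    rw [← Units.val_pow_eq_pow_val, ← zpow_natCast, ← zpow_mul, mul_comm, zpow_mul, zpow_natCast, hz]
    simp
  set η := gaussPeriod (traceChar p F) g (Q + 1) with hη
  -- A radical of size `1` gives the square `Q ^ (2 * s)`, one of size `Q ^ 2` gives `Q ^ (2 * (s +
  -- 1))`; the signs come from `eq_neg_pow_of_sq_eq`.
  have hcases : ∀ k, 1 + ((Q : ℂ) + 1) * η k = (-Q : ℂ) ^ s ∨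
      1 + ((Q : ℂ) + 1) * η k = (-Q : ℂ) ^ (s + 1) := by
    intro k
    have h1 := sum_traceChar_hermitian_mul_self p hF ht ((g ^ k : Fˣ) : F)
    rw [sum_pow_mul_eq_gaussPeriod _ hg hdvd1 (Nat.succ_ne_zero Q)] at h1
    have h2 := card_rad F (q := p ^ (2 * j)) (hQ.trans (Nat.pow_le_pow_right hp.pos (by omega)))
      (by rw [hF, pow_mul p (2 * j) s]; exact Nat.sub_one_dvd_pow_sub_one _ _)
      (a := ((g ^ k : Fˣ) : F)) (b := ((g ^ k : Fˣ) : F) ^ p ^ j) (pow_ne_zero _ (Units.ne_zero _))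
    have hcF : (Fintype.card F : ℂ) = (Q : ℂ) ^ (2 * s) := by
      rw [hF, ← hQc]
      push_cast
      rw [← pow_mul]
      congr 1
      ring
    rw [hcF, Nat.cast_succ] at h1
    rcases h2 with h2 | h2
    · left
      apply eq_neg_pow_of_sq_eq hQ (gaussPeriod_isIntegral p g _ k)
      rw [h1, h2]
      simp
    · right
      apply eq_neg_pow_of_sq_eq hQ (gaussPeriod_isIntegral p g _ k)
      rw [h1, h2]
      push_cast
      rw [mul_comm 2 j, pow_mul (p : ℂ), hQc]
      ring
  have hne : (-Q : ℂ) ^ s ≠ 0 := pow_ne_zero _ (neg_ne_zero.2 hQ0)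
  have hsum : ∑ k ∈ Finset.range (Q + 1), η k = -1 := by
    rw [← gaussPeriod_one (traceChar_isPrimitive p) hg,
      gaussPeriod_mul _ g (e := 1) (c := Q + 1) (by omega) one_ne_zero (by simpa using hdvd1) 0]
    simp [hη]
  set B := (Finset.range (Q + 1)).filter
    fun k => 1 + ((Q : ℂ) + 1) * η k = (-Q : ℂ) ^ (s + 1) with hB
  have hval : ∀ k, ((Q : ℂ) + 1) * η k = (-Q : ℂ) ^ s - 1 -
      if 1 + ((Q : ℂ) + 1) * η k = (-Q : ℂ) ^ (s + 1) then ((Q : ℂ) + 1) * (-Q : ℂ) ^ s else 0 := by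
    intro k
    split_ifs with h
    · linear_combination h
    · linear_combination (hcases k).resolve_right h
  -- The values `(Q + 1) * η k` sum to `-(Q + 1)`. Without exceptions they would sum to `(Q + 1) *
  -- ((-Q) ^ s - 1)`, and each exception lowers this by `(Q + 1) * (-Q) ^ s`.
  have hcardB : B.card = 1 := by
    have h1 : ∑ k ∈ Finset.range (Q + 1), ((Q : ℂ) + 1) * η k = ((Q : ℂ) + 1) * (-1) := by
      rw [← Finset.mul_sum, hsum]
    rw [Finset.sum_congr rfl fun k _ => hval k, Finset.sum_sub_distrib, Finset.sum_const,
      Finset.card_range, ← Finset.sum_filter, Finset.sum_const, nsmul_eq_mul, nsmul_eq_mul] at h1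
    push_cast at h1
    have h2 : (((Q : ℂ) + 1) * (-Q : ℂ) ^ s) * (B.card : ℂ) = (((Q : ℂ) + 1) * (-Q : ℂ) ^ s) * 1 := by
      linear_combination -h1
    exact_mod_cast mul_left_cancel₀ (mul_ne_zero hQ1 hne) h2
  obtain ⟨k₀, hk₀⟩ := Finset.card_eq_one.1 hcardB
  have hk₀lt : k₀ < Q + 1 := by
    have : k₀ ∈ B := by rw [hk₀]; simp
    simpa using (Finset.mem_filter.1 this).1
  refine ⟨k₀, fun k => ?_⟩
  have hmem : (k ≡ k₀ [MOD Q + 1]) ↔ 1 + ((Q : ℂ) + 1) * η k = (-Q : ℂ) ^ (s + 1) := by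
    rw [hη, ← gaussPeriod_mod _ g hdvd1 k, ← hη]
    have : k % (Q + 1) ∈ B ↔ k % (Q + 1) = k₀ := by rw [hk₀]; simp
    rw [hB, Finset.mem_filter, and_iff_right (Finset.mem_range.2 (Nat.mod_lt _ (Nat.succ_pos Q)))]
      at this
    rw [this, Nat.ModEq, Nat.mod_eq_of_lt hk₀lt]
  simp only [hmem]
  exact hval k

/-- **Semi-primitive (uniform) cyclotomy**: the Gaussian periods of order `e ∣ p ^ j + 1` of the
field with `p ^ (2 * j * s)` elements take two values, one of them on a single class. -/
theorem exists_gaussPeriod_semiprimitive (p : ℕ) [Fact p.Prime] {F : Type*} [Field F]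
    [Fintype F] [Algebra (ZMod p) F] {j s e : ℕ} (hj : 0 < j) (hej : e ∣ p ^ j + 1)
    (hF : Fintype.card F = p ^ (2 * j * s)) {g : Fˣ} (hg : ∀ x : Fˣ, x ∈ Subgroup.zpowers g) :
    ∃ k₀ : ℕ, ∀ k : ℕ, gaussPeriod (traceChar p F) g e k =
      ((-(p : ℂ) ^ j) ^ s - 1) / e - (if k ≡ k₀ [MOD e] then (-(p : ℂ) ^ j) ^ s else 0) := by
  obtain ⟨k₀, hk₀⟩ := exists_gaussPeriod_prime_pow_add_one p hj hF hg
  obtain ⟨c, hc⟩ := hej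
  have he0 : e ≠ 0 := by rintro rfl; simp at hc
  have hc0 : c ≠ 0 := by rintro rfl; simp at hc
  have hdvd : e * c ∣ Fintype.card F - 1 := by
    rw [← hc, hF]
    exact (dvd_mul_right _ _).trans (mul_sub_one_dvd dvd_rfl)
  refine ⟨k₀, fun k => ?_⟩
  have he0' : (e : ℂ) ≠ 0 := by exact_mod_cast he0
  have hc0' : (c : ℂ) ≠ 0 := by exact_mod_cast hc0
  have hcc : (p : ℂ) ^ j + 1 = e * c := by exact_mod_cast hc
  rw [hc, hcc] at hk₀
  have h1 : (e * c : ℂ) * gaussPeriod (traceChar p F) g e k =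
      c * ((-(p : ℂ) ^ j) ^ s - 1) - (if k ≡ k₀ [MOD e] then 1 else 0) *
        ((e * c : ℂ) * (-(p : ℂ) ^ j) ^ s) := by
    rw [gaussPeriod_mul _ g hc0 he0 hdvd, Finset.mul_sum, Finset.sum_congr rfl fun t _ => hk₀ _,
      Finset.sum_sub_distrib, ← Finset.sum_filter, Finset.sum_const, Finset.sum_const,
      card_filter_modEq he0 hc0, Finset.card_range, nsmul_eq_mul, nsmul_eq_mul]
    push_cast
    rfl
  apply mul_left_cancel₀ (mul_ne_zero he0' hc0')
  rw [h1]
  split_ifs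
  · field_simp
  · field_simp
    ring

/-! ### Cyclotomic classes and their Cayley graphs. -/

/-- The cyclotomic class `g ^ k ⟨g ^ e⟩` as a finite subset of the field. -/
noncomputable def cyclotomicFinset {F : Type*} [Field F] [Fintype F] (g : Fˣ) (e k : ℕ) :
    Finset F := by
  classical
  exact (Finset.range ((Fintype.card F - 1) / e)).image fun i => ((g ^ (k + e * i) : Fˣ) : F)

section Cyclotomic

variable {F : Type*} [Field F] [Fintype F] {g : Fˣ} {e : ℕ}

theorem orderOf_generator_pow (hg : ∀ x : Fˣ, x ∈ Subgroup.zpowers g)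
    (he : e ∣ Fintype.card F - 1) : orderOf (g ^ e) = (Fintype.card F - 1) / e := by
  have hM : 0 < Fintype.card F - 1 := Nat.sub_pos_of_lt Fintype.one_lt_card
  have ho : orderOf g = Fintype.card F - 1 := by
    rw [orderOf_eq_card_of_forall_mem_zpowers hg, Nat.card_units, Nat.card_eq_fintype_card]
  rw [orderOf_pow_of_dvd (Nat.pos_of_dvd_of_pos he hM).ne' (ho ▸ he), ho]

theorem index_zpowers_generator_pow (hg : ∀ x : Fˣ, x ∈ Subgroup.zpowers g)
    (he : e ∣ Fintype.card F - 1) : (Subgroup.zpowers (g ^ e)).index = e := by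
  have hM : 0 < Fintype.card F - 1 := Nat.sub_pos_of_lt Fintype.one_lt_card
  have h := Subgroup.card_mul_index (Subgroup.zpowers (g ^ e))
  rw [Nat.card_zpowers, orderOf_generator_pow hg he, Nat.card_units,
    Nat.card_eq_fintype_card] at h
  obtain ⟨m, hm⟩ := he
  have he0 : e ≠ 0 := by rintro rfl; simp [hm] at hM
  have hm0 : 0 < m := Nat.pos_of_ne_zero (by rintro rfl; simp [hm] at hM)
  rw [hm, Nat.mul_div_cancel_left _ (Nat.pos_of_ne_zero he0), mul_comm e m] at h
  exact Nat.eq_of_mul_eq_mul_left hm0 h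

theorem mem_cyclotomicClass_iff (hg : ∀ x : Fˣ, x ∈ Subgroup.zpowers g)
    (he : e ∣ Fintype.card F - 1) (k : ℕ) (x : Fˣ) :
    x ∈ cyclotomicClass g e k ↔ (x : F) ∈ cyclotomicFinset g e k := by
  classical
  have hz : ∀ h : Fˣ, h ∈ Subgroup.zpowers (g ^ e) ↔
      ∃ i < (Fintype.card F - 1) / e, (g ^ e) ^ i = h := by
    intro h
    rw [mem_zpowers_iff_mem_range_orderOf, orderOf_generator_pow hg he]
    simp
  simp only [cyclotomicClass, Set.mem_ofPred_eq, hz, cyclotomicFinset, Finset.mem_image,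
    Finset.mem_range, Units.val_inj]
  constructor
  · rintro ⟨_, ⟨i, hi, rfl⟩, rfl⟩
    exact ⟨i, hi, by rw [pow_add, pow_mul]⟩
  · rintro ⟨i, hi, rfl⟩
    exact ⟨_, ⟨i, hi, rfl⟩, by rw [pow_add, pow_mul]⟩

theorem zero_notMem_cyclotomicFinset (k : ℕ) : (0 : F) ∉ cyclotomicFinset g e k := by
  classical
  simp [cyclotomicFinset]

theorem cyclotomicUnion_singleton (hg : ∀ x : Fˣ, x ∈ Subgroup.zpowers g)
    (he : e ∣ Fintype.card F - 1) (k : ℕ) :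
    cyclotomicUnion g e {k} = (cyclotomicFinset g e k : Set F) := by
  ext x
  simp only [cyclotomicUnion, Finset.mem_singleton, exists_eq_left, Set.mem_ofPred_eq,
    Finset.mem_coe, mem_cyclotomicClass_iff hg he]
  constructor
  · rintro ⟨u, hu, rfl⟩
    exact hu
  · intro hx
    have hx0 : x ≠ 0 := fun h => zero_notMem_cyclotomicFinset k (h ▸ hx)
    exact ⟨Units.mk0 x hx0, hx, rfl⟩

theorem sum_cyclotomicFinset (hg : ∀ x : Fˣ, x ∈ Subgroup.zpowers g)
    (he : e ∣ Fintype.card F - 1) (k : ℕ) {M : Type*} [AddCommMonoid M] (f : F → M) :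
    ∑ x ∈ cyclotomicFinset g e k, f x =
      ∑ i ∈ Finset.range ((Fintype.card F - 1) / e), f ((g ^ (k + e * i) : Fˣ) : F) := by
  classical
  refine Finset.sum_image fun a ha b hb hab => ?_
  rw [Units.val_inj, pow_add, pow_add, mul_right_inj, pow_mul, pow_mul] at hab
  have ho := orderOf_generator_pow hg he
  exact pow_injOn_Iio_orderOf (by simpa [ho] using ha) (by simpa [ho] using hb) hab

theorem card_cyclotomicFinset (hg : ∀ x : Fˣ, x ∈ Subgroup.zpowers g)
    (he : e ∣ Fintype.card F - 1) (k : ℕ) :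
    (cyclotomicFinset g e k).card = (Fintype.card F - 1) / e := by
  rw [Finset.card_eq_sum_ones, sum_cyclotomicFinset hg he]
  simp

theorem charSum_cyclotomicFinset (hg : ∀ x : Fˣ, x ∈ Subgroup.zpowers g)
    (he : e ∣ Fintype.card F - 1) (k m : ℕ) (ψ : AddChar F ℂ) :
    ∑ x ∈ cyclotomicFinset g e k, ψ (x * ((g ^ m : Fˣ) : F)) = gaussPeriod ψ g e (k + m) := by
  rw [sum_cyclotomicFinset hg he, gaussPeriod]
  refine Finset.sum_congr rfl fun i _ => ?_
  rw [← Units.val_mul, ← pow_add]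
  congr 3
  ring

end Cyclotomic

theorem mul_mem_cyclotomicClass {F : Type*} [Field F] {g : Fˣ} {e k : ℕ} {c x : Fˣ}
    (hc : c ∈ Subgroup.zpowers (g ^ e))
    (hx : x ∈ cyclotomicClass g e k) : x * c ∈ cyclotomicClass g e k := by
  obtain ⟨h, hh, rfl⟩ := hx
  exact ⟨h * c, mul_mem hh hc, mul_assoc _ _ _⟩

theorem scalarUnits_le_zpowers (p : ℕ) [Fact p.Prime] {F : Type*} [Field F] [Fintype F]
    [Algebra (ZMod p) F] {e : ℕ} (he : e * (p - 1) ∣ Fintype.card F - 1) {g : Fˣ}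
    (hg : ∀ x : Fˣ, x ∈ Subgroup.zpowers g) :
    scalarUnits (ZMod p) F ≤ Subgroup.zpowers (g ^ e) := fun _ hx =>
  mem_zpowers_pow_of_pow_eq_one hg (Nat.sub_ne_zero_of_lt (Fact.out : p.Prime).one_lt)
    (by rwa [Nat.card_units, Nat.card_eq_fintype_card]) (scalarUnits_pow_eq_one p hx)

/-- Semi-primitive cyclotomic strongly regular graphs. -/
theorem isStronglyRegularCayley_semiprimitive (p : ℕ) [Fact p.Prime] {F : Type*} [Field F]
    [Fintype F] [Algebra (ZMod p) F] {j s e : ℕ} (hj : 0 < j) (he2 : 2 ≤ e) (hej : e ∣ p ^ j + 1)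
    (hF : Fintype.card F = p ^ (2 * j * s)) {g : Fˣ} (hg : ∀ x : Fˣ, x ∈ Subgroup.zpowers g)
    (k : ℕ) {θ₁ θ₂ : ℂ} (hθ₁ : e * θ₁ = (-(p : ℂ) ^ j) ^ s - 1)
    (hθ₂ : θ₂ = θ₁ - (-(p : ℂ) ^ j) ^ s) :
    ∃ lam mu : ℕ, (mu : ℂ) = ((Fintype.card F - 1) / e : ℕ) + θ₁ * θ₂ ∧
      (lam : ℂ) = mu + θ₁ + θ₂ ∧
      IsStronglyRegularCayley (cyclotomicUnion g e {k}) (Fintype.card F)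
        ((Fintype.card F - 1) / e) lam mu := by
  classical
  have hM : 0 < Fintype.card F - 1 := Nat.sub_pos_of_lt Fintype.one_lt_card
  have hdvd : e * (p - 1) ∣ Fintype.card F - 1 := hF ▸ mul_sub_one_dvd hej
  have he : e ∣ Fintype.card F - 1 := (dvd_mul_right _ _).trans hdvd
  have hcard := card_cyclotomicFinset hg he k
  have he0 : (e : ℂ) ≠ 0 := by exact_mod_cast (by omega : e ≠ 0)
  rw [cyclotomicUnion_singleton hg he, ← hcard]
  apply isStronglyRegularCayley_of_charSum (traceChar_isPrimitive p)
    (zero_notMem_cyclotomicFinset k)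
  · intro x hx
    have hx0 : x ≠ 0 := fun h => zero_notMem_cyclotomicFinset k (h ▸ hx)
    have h1 := mul_mem_cyclotomicClass
      (scalarUnits_le_zpowers p hdvd hg (neg_one_mem_scalarUnits p))
      ((mem_cyclotomicClass_iff hg he k (Units.mk0 x hx0)).2 hx)
    simpa using (mem_cyclotomicClass_iff hg he k _).1 h1
  · rw [← Finset.card_pos, hcard]
    exact Nat.div_pos (Nat.le_of_dvd hM he) (by omega)
  · by_contra! h
    have h1 : Finset.univ.erase (0 : F) ⊆ cyclotomicFinset g e k := fun x hx =>
      h x (Finset.ne_of_mem_erase hx)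
    have h2 := Finset.card_le_card h1
    rw [Finset.card_erase_of_mem (Finset.mem_univ _), hcard, Finset.card_univ] at h2
    exact absurd (Nat.div_lt_self hM he2) (not_lt.2 h2)
  · intro b hb
    obtain ⟨m, hm⟩ := (Submonoid.mem_powers_iff _ _).1
      (mem_powers_iff_mem_zpowers.2 (hg (Units.mk0 b hb)))
    have hb' : b = ((g ^ m : Fˣ) : F) := by rw [hm]; rfl
    obtain ⟨k₀, hk₀⟩ := exists_gaussPeriod_semiprimitive p hj hej hF hg
    rw [hb', charSum_cyclotomicFinset hg he, hk₀, ← hθ₁, mul_div_cancel_left₀ _ he0]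
    split_ifs
    · exact Or.inr hθ₂.symm
    · exact Or.inl (sub_zero _)

/-! ### Intersection numbers with the Singer difference set. -/

/-- `A` is a union of cosets of `H`, hence the full preimage of its image. -/
theorem ncard_image_mk_mul_card {G : Type*} [Group G] (H : Subgroup G) {A : Set G}
    (hA : ∀ x ∈ A, ∀ h ∈ H, x * h ∈ A) :
    Nat.card H * ((fun x : G => (QuotientGroup.mk x : G ⧸ H)) '' A).ncard = A.ncard := by
  have hpre : (QuotientGroup.mk : G → G ⧸ H) ⁻¹'
      ((fun x : G => (QuotientGroup.mk x : G ⧸ H)) '' A) = A := by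
    ext x
    constructor
    · rintro ⟨a, ha, hax⟩
      have := hA a ha _ (QuotientGroup.eq.1 hax)
      rwa [mul_inv_cancel_left] at this
    · exact fun hx => ⟨x, hx, rfl⟩
  conv_rhs => rw [← hpre]
  rw [← Nat.card_coe_set_eq, ← Nat.card_coe_set_eq,
    Nat.card_congr (QuotientGroup.preimageMkEquivSubgroupProdSet _ _), Nat.card_prod]

theorem card_scalarUnits (p : ℕ) [Fact p.Prime] (F : Type*) [Field F] [Algebra (ZMod p) F] :
    Nat.card (scalarUnits (ZMod p) F) = p - 1 := by
  have hinj : Function.Injective (Units.map (algebraMap (ZMod p) F : ZMod p →* F)) :=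
    Units.map_injective (algebraMap (ZMod p) F).injective
  rw [scalarUnits, ← Nat.card_congr (MonoidHom.ofInjective hinj).toEquiv, Nat.card_units,
    Nat.card_zmod]

/-- The intersection numbers with the Singer difference set count trace zero elements. -/
theorem sub_one_mul_singerNumber (p : ℕ) [Fact p.Prime] {F : Type*} [Field F] [Fintype F]
    [Algebra (ZMod p) F] {e : ℕ} (hdvd : e * (p - 1) ∣ Fintype.card F - 1) {g : Fˣ}
    (hg : ∀ x : Fˣ, x ∈ Subgroup.zpowers g) (k : ℕ) :
    (p - 1) * singerNumber (ZMod p) g e k =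
      ((cyclotomicFinset g e k).filter fun x => Algebra.trace (ZMod p) F x = 0).card := by
  have he : e ∣ Fintype.card F - 1 := (dvd_mul_right _ _).trans hdvd
  have htr : ∀ (x : Fˣ), ∀ h ∈ scalarUnits (ZMod p) F, Algebra.trace (ZMod p) F (x : F) = 0 →
      Algebra.trace (ZMod p) F ((x * h : Fˣ) : F) = 0 := by
    rintro x _ ⟨c, rfl⟩ hx
    have : ((x * Units.map (algebraMap (ZMod p) F : ZMod p →* F) c : Fˣ) : F) =
        (c : ZMod p) • (x : F) := by
      rw [Algebra.smul_def, mul_comm]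
      rfl
    rw [this, map_smul, hx, smul_zero]
  set A : Set Fˣ := {x | x ∈ cyclotomicClass g e k ∧ Algebra.trace (ZMod p) F (x : F) = 0} with hA
  have hset : singerSet (ZMod p) F ∩ (fun x : Fˣ => (QuotientGroup.mk x : Fˣ ⧸
      scalarUnits (ZMod p) F)) '' cyclotomicClass g e k =
      (fun x : Fˣ => (QuotientGroup.mk x : Fˣ ⧸ scalarUnits (ZMod p) F)) '' A := by
    ext c
    constructor
    · rintro ⟨⟨x, hx, rfl⟩, y, hy, hyx⟩
      refine ⟨y, ⟨hy, ?_⟩, hyx⟩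
      have := htr x _ (QuotientGroup.eq.1 hyx.symm) hx
      rwa [mul_inv_cancel_left] at this
    · rintro ⟨x, hx, rfl⟩
      exact ⟨⟨x, hx.2, rfl⟩, x, hx.1, rfl⟩
  rw [singerNumber, hset, ← card_scalarUnits p F, ncard_image_mk_mul_card,
    ← Set.ncard_image_of_injective A Units.val_injective, ← Set.ncard_coe_finset]
  · congr 1
    ext x
    simp only [Set.mem_image, hA, Set.mem_ofPred_eq, mem_cyclotomicClass_iff hg he,
      Finset.mem_coe, Finset.mem_filter]
    constructor
    · rintro ⟨u, hu, rfl⟩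
      exact hu
    · intro hx
      have hx0 : x ≠ 0 := fun h => zero_notMem_cyclotomicFinset k (h ▸ hx.1)
      exact ⟨Units.mk0 x hx0, hx, rfl⟩
  · rintro x ⟨hx1, hx2⟩ h hh
    exact ⟨mul_mem_cyclotomicClass (scalarUnits_le_zpowers p hdvd hg hh) hx1, htr x h hh hx2⟩

/-- The intersection numbers with the Singer difference set are affine in the Gaussian periods. -/
theorem mul_singerNumber_eq (p : ℕ) [Fact p.Prime] {F : Type*} [Field F] [Fintype F]
    [Algebra (ZMod p) F] {e : ℕ} (hdvd : e * (p - 1) ∣ Fintype.card F - 1) {g : Fˣ}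
    (hg : ∀ x : Fˣ, x ∈ Subgroup.zpowers g) (k : ℕ) :
    (p : ℂ) * ((p - 1 : ℕ) * singerNumber (ZMod p) g e k) =
      ((Fintype.card F - 1) / e : ℕ) + (p - 1 : ℕ) * gaussPeriod (traceChar p F) g e k := by
  classical
  have he : e ∣ Fintype.card F - 1 := (dvd_mul_right _ _).trans hdvd
  -- Trace zero is detected by orthogonality on `ZMod p`: the inner sum over `c` is `p` if `x` has
  -- trace zero and `0` otherwise.
  have h1 : (p : ℂ) * ((p - 1 : ℕ) * singerNumber (ZMod p) g e k) =
      ∑ x ∈ cyclotomicFinset g e k, ∑ c : ZMod p, traceChar p F (x * algebraMap (ZMod p) F c) := by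
    rw [← Nat.cast_mul, sub_one_mul_singerNumber p hdvd hg, Finset.card_filter]
    push_cast
    rw [Finset.mul_sum]
    refine Finset.sum_congr rfl fun x _ => ?_
    have : ∀ c : ZMod p, traceChar p F (x * algebraMap (ZMod p) F c) =
        ZMod.stdAddChar (c * Algebra.trace (ZMod p) F x) := by
      intro c
      rw [traceChar_apply, mul_comm, ← Algebra.smul_def, map_smul, smul_eq_mul]
    simp_rw [this]
    rw [AddChar.sum_mulShift _ (ZMod.isPrimitive_stdAddChar p), ZMod.card]
    split_ifs <;> simp
  rw [h1, Finset.sum_comm, Fintype.sum_eq_add_sum_subtype_ne _ 0,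
    ← (unitsEquivNeZero (G₀ := ZMod p)).sum_comp (fun c => ∑ x ∈ cyclotomicFinset g e k,
      traceChar p F (x * algebraMap (ZMod p) F c))]
  -- Nonzero scalars lie in `⟨g ^ e⟩`, so multiplying by them permutes the class.
  have hconst : ∀ c : (ZMod p)ˣ, ∑ x ∈ cyclotomicFinset g e k,
      traceChar p F (x * algebraMap (ZMod p) F c) = gaussPeriod (traceChar p F) g e k := by
    intro c
    have hc := scalarUnits_le_zpowers p hdvd hg ⟨c, rfl⟩
    obtain ⟨m, hm⟩ := (Submonoid.mem_powers_iff _ _).1 (mem_powers_iff_mem_zpowers.2 hc)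
    have hc' : algebraMap (ZMod p) F c = ((g ^ (e * m) : Fˣ) : F) := by
      rw [pow_mul, hm]
      rfl
    rw [hc', charSum_cyclotomicFinset hg he, gaussPeriod_add_mul _ g he]
  congr 1
  · simp [card_cyclotomicFinset hg he]
  · refine (Finset.sum_congr rfl fun c _ => hconst c).trans ?_
    rw [Finset.sum_const, Finset.card_univ, ZMod.card_units_eq_totient,
      Nat.totient_prime Fact.out, nsmul_eq_mul]

/-- Singer numbers agree exactly when the periods do, so the index of the exceptional period is
singled out; `2 ≤ e` provides another index, hence a second value. -/
theorem exists_isSubdifferenceIndexSet_singleton (p : ℕ) [Fact p.Prime] {F : Type*} [Field F]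
    [Fintype F] [Algebra (ZMod p) F] {j s e : ℕ} (hj : 0 < j) (he2 : 2 ≤ e) (hej : e ∣ p ^ j + 1)
    (hF : Fintype.card F = p ^ (2 * j * s)) {g : Fˣ} (hg : ∀ x : Fˣ, x ∈ Subgroup.zpowers g) :
    ∃ i, IsSubdifferenceIndexSet (ZMod p) g e {i} := by
  have hp := (Fact.out : p.Prime)
  have hdvd : e * (p - 1) ∣ Fintype.card F - 1 := hF ▸ mul_sub_one_dvd hej
  obtain ⟨k₀, hk₀⟩ := exists_gaussPeriod_semiprimitive p hj hej hF hg
  have hp0 : (p : ℂ) ≠ 0 := by exact_mod_cast hp.ne_zero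
  have hp1 : ((p - 1 : ℕ) : ℂ) ≠ 0 := by exact_mod_cast Nat.sub_ne_zero_of_lt hp.one_lt
  have hiff : ∀ i k, singerNumber (ZMod p) g e i = singerNumber (ZMod p) g e k ↔
      ((i ≡ k₀ [MOD e]) ↔ (k ≡ k₀ [MOD e])) := by
    intro i k
    have hP : (-(p : ℂ) ^ j) ^ s ≠ 0 := pow_ne_zero _ (neg_ne_zero.2 (pow_ne_zero _ hp0))
    have hi := mul_singerNumber_eq p hdvd hg i
    have hk := mul_singerNumber_eq p hdvd hg k
    have h1 : singerNumber (ZMod p) g e i = singerNumber (ZMod p) g e k ↔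
        gaussPeriod (traceChar p F) g e i = gaussPeriod (traceChar p F) g e k := by
      constructor
      · intro h
        rw [h] at hi
        exact mul_left_cancel₀ hp1 (add_left_cancel (hi.symm.trans hk))
      · intro h
        rw [h, ← hk] at hi
        exact_mod_cast mul_left_cancel₀ hp1 (mul_left_cancel₀ hp0 hi)
    rw [h1, hk₀, hk₀, sub_right_inj]
    by_cases h2 : i ≡ k₀ [MOD e] <;> by_cases h3 : k ≡ k₀ [MOD e] <;> simp [h2, h3, hP, hP.symm]
  have hlt : k₀ % e < e := Nat.mod_lt _ (by omega)
  have hmod : ∀ i < e, i ≡ k₀ [MOD e] ↔ i = k₀ % e := fun i hi => by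
    rw [Nat.ModEq, Nat.mod_eq_of_lt hi]
  obtain ⟨i₁, hi₁, hne⟩ : ∃ i < e, i ≠ k₀ % e := by
    by_cases h : k₀ % e = 0
    · exact ⟨1, by omega, by omega⟩
    · exact ⟨0, by omega, fun h' => h h'.symm⟩
  refine ⟨k₀ % e, singerNumber (ZMod p) g e (k₀ % e), singerNumber (ZMod p) g e i₁, ?_, ?_,
    ⟨_, hlt, rfl⟩, ⟨_, hi₁, rfl⟩, ?_⟩
  · rw [Ne, hiff, hmod _ hlt, hmod _ hi₁]
    simp [hne]
  · intro i hi
    rw [hiff, hiff, hmod _ hlt, hmod _ hi₁, hmod _ hi]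
    simp [hne, em]
  · intro i
    rw [Finset.mem_singleton]
    constructor
    · rintro rfl
      exact ⟨hlt, rfl⟩
    · rintro ⟨hi, h⟩
      rw [hiff, hmod _ hlt, hmod _ hi] at h
      exact h.2 rfl

/-! ### The lifted graph. -/

theorem corollary3p2 (p : ℕ) [Fact p.Prime] (e j s : ℕ) (he : 2 ≤ e) (hs : 2 ≤ s)
    (hj : 0 < j) (hej : e ∣ p ^ j + 1) (hmin : ∀ i, 0 < i → i < j → ¬ e ∣ p ^ i + 1)
    (n r : ℕ) (hn : n = p ^ (2 * j * s)) (hr : r = (n - 1) / e)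
    (K L : Type*) [Field K] [Fintype K] [Field L] [Fintype L]
    [Algebra (ZMod p) K] [Algebra K L]
    (hK : Fintype.card K = n) (hL : Module.finrank K L = 2)
    (γ : Lˣ) (hγ : ∀ x : Lˣ, x ∈ Subgroup.zpowers γ)
    (ω : Kˣ) (hω : ω = Units.map (Algebra.norm K : L →* K) γ) :
    e ∣ n - 1 ∧
    IsLiftableCyclotomic (ZMod p) ω e ∧
    ∃ I : Finset ℕ, I.card = 1 ∧ IsSubdifferenceIndexSet (ZMod p) ω e I ∧
      ∃ lam mu : ℕ, (lam : ℤ) = -(n : ℤ) + (r : ℤ) ^ 2 + 3 * (r : ℤ) ∧ mu = r ^ 2 + r ∧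
        IsStronglyRegularCayley (cyclotomicUnion γ e I) (n ^ 2) (r * (n + 1)) lam mu := by
  have hp := (Fact.out : p.Prime)
  -- The norm is surjective on units, so it maps a generator to a generator.
  have hωgen : ∀ x : Kˣ, x ∈ Subgroup.zpowers ω := by
    intro x
    obtain ⟨y, rfl⟩ := FiniteField.unitsMap_norm_surjective K L x
    obtain ⟨m, rfl⟩ := Subgroup.mem_zpowers_iff.1 (hγ y)
    exact Subgroup.mem_zpowers_iff.2 ⟨m, by rw [hω, map_zpow]⟩
  have hF : Fintype.card K = p ^ (2 * j * s) := hK.trans hn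
  have hdvd : e * (p - 1) ∣ Fintype.card K - 1 := hF ▸ mul_sub_one_dvd hej
  have hdvd1 : e ∣ Fintype.card K - 1 := (dvd_mul_right _ _).trans hdvd
  have he0 : (e : ℂ) ≠ 0 := by exact_mod_cast (by omega : e ≠ 0)
  refine ⟨hK ▸ hdvd1, ⟨scalarUnits_le_zpowers p hdvd hωgen,
    index_zpowers_generator_pow hωgen hdvd1, ?_⟩, ?_⟩
  · obtain ⟨lam, mu, -, -, h⟩ := isStronglyRegularCayley_semiprimitive p hj he hej hF hωgen 0
      (θ₁ := ((-(p : ℂ) ^ j) ^ s - 1) / e) (mul_div_cancel₀ _ he0) rfl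
    exact ⟨_, _, lam, mu, h⟩
  · obtain ⟨i, hi⟩ := exists_isSubdifferenceIndexSet_singleton p hj he hej hF hωgen
    refine ⟨{i}, Finset.card_singleton i, hi, ?_⟩
    let _ : Algebra (ZMod p) L := ((algebraMap K L).comp (algebraMap (ZMod p) K)).toAlgebra
    have hLn : Fintype.card L = n ^ 2 := by
      rw [Module.card_eq_pow_finrank (K := K), hL, hK]
    have hFL : Fintype.card L = p ^ (2 * j * (2 * s)) := by
      rw [hLn, hn, ← pow_mul]
      congr 1
      ring
    have hn1 : 1 ≤ n := hn ▸ Nat.one_le_pow _ _ hp.pos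
    have hre : e * r = n - 1 := by rw [hr, ← hK, Nat.mul_div_cancel' hdvd1]
    have hrec : (e : ℂ) * r = n - 1 := by
      rw [← Nat.cast_one, ← Nat.cast_sub hn1]
      exact_mod_cast hre
    -- Doubling `s` makes the exponent even, so the sign disappears.
    have hP : (-(p : ℂ) ^ j) ^ (2 * s) = n := by
      rw [pow_mul, neg_sq, ← pow_mul, ← pow_mul, hn]
      push_cast
      congr 1
      ring
    have hk : (Fintype.card L - 1) / e = r * (n + 1) := by
      have : Fintype.card L - 1 = e * (r * (n + 1)) := by
        rw [hLn, ← mul_assoc, hre, mul_comm, ← Nat.sq_sub_sq, one_pow]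
      rw [this, Nat.mul_div_cancel_left _ (by omega)]
    -- Here `θ₁ = (n - 1) / e = r`, so `mu = r (n + 1) + r (r - n) = r ^ 2 + r` and `lam = mu + 2 r
    -- - n`.
    obtain ⟨lam, mu, hmu, hlam, h⟩ := isStronglyRegularCayley_semiprimitive p hj he hej hFL hγ i
      (θ₁ := r) (θ₂ := r - n) (by rw [hP, hrec]) (by rw [hP])
    rw [hk] at hmu h
    rw [hLn] at h
    refine ⟨lam, mu, ?_, ?_, h⟩
    · have : (lam : ℂ) = -(n : ℂ) + (r : ℂ) ^ 2 + 3 * (r : ℂ) := by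
        rw [hlam, hmu]
        push_cast
        ring
      exact_mod_cast this
    · have : (mu : ℂ) = (r : ℂ) ^ 2 + r := by
        rw [hmu]
        push_cast
        ring
      exact_mod_cast this
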